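/- Let $(\mathcal X,\mathcal F,\pi)$ be a probability space and $P$ a Markov kernel on $(\mathcal X,\mathcal F)$ that is reversible with respect to $\pi$, i.e. $P(x,dy)\,\pi(dx)=P(y,dx)\,\pi(dy)$. Suppose that * $P$ is $\varphi$-irreducible: there is a non-zero $\sigma$-finite measure $\varphi$ on $(\mathcal X,\mathcal F)$ such that for every $A\in\mathcal F$ with $\varphi(A)>0$ and every $x\in\mathcal X$ there is $n\in\mathbb N$ with $P^n(x,A)>0$; * $P$ is aperiodic: there are no $d\ge 2$ and pairwise disjoint sets $S_1,\dots,S_d\in\mathcal F$ with $\pi(S_i)>0$ for all $i$, such that $P(x,S_{i+1})=1$ for all $x\in S_i$, $1\le i\le d-1$, and $P(x,S_1)=1$ for all $x\in S_d$. Let $f:\mathcal X\to\mathbb R$ satisfy $\int f^2\,d\pi<\infty$ and $\int f\,d\pi=0$. Write $\langle g,h\rangle=\int gh\,d\pi$, $\|g\|=\sqrt{\langle g,g\rangle}$ and $(\mathcal Pg)(x)=\int g(y)\,P(x,dy)$. Let $X_0,X_1,X_2,\dots$ be the Markov chain with kernel $P$ and $X_0\sim\pi$, and put $\gamma_k=\operatorname{Cov}(f(X_0),f(X_k))$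 for $k\ge 0$. Then the limit defining the asymptotic variance, $$v(f,P)=\lim_{N\to\infty}\frac1N\operatorname{Var}\Big(\sum_{k=0}^{N-1}f(X_k)\Big),$$ and the two series below, as limits of their partial sums, exist in the extended reals (the value $+\infty$ is allowed), and $$v(f,P)=\|f\|^2+2\sum_{k=1}^\infty\langle f,\mathcal P^kf\rangle=\gamma_0+2\sum_{k=1}^\infty\gamma_k .$$ -/

import Mathlib

open MeasureTheory ProbabilityTheory Filter Topology

namespace ReversibleChain

variable {𝒳 : Type*} [MeasurableSpace 𝒳]

/-- `P` is `φ`-irreducible for some non-zero σ-finite measure `φ`: every measurable set of positive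
`φ`-measure is reached with positive probability, in some number of steps, from every state. -/
def IsPhiIrreducible (P : Kernel 𝒳 𝒳) : Prop :=
  ∃ φ : Measure 𝒳, SigmaFinite φ ∧ φ ≠ 0 ∧ Kernel.IsIrreducible φ P

/-- `P` is periodic with period `d ≥ 2`: there are pairwise disjoint measurable sets
`S 0, …, S (d - 1)`, of positive `π`-measure, which the chain visits cyclically
(the indices are integers modulo `d`).  The sets must not be null: with empty sets
every kernel would be periodic. -/
def IsPeriodicWith (P : Kernel 𝒳 𝒳) (π : Measure 𝒳) (d : ℕ) : Prop :=
  2 ≤ d ∧ ∃ S : ZMod d → Set 𝒳,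
    (∀ i, MeasurableSet (S i)) ∧ (∀ i, 0 < π (S i)) ∧
    (∀ i j, i ≠ j → Disjoint (S i) (S j)) ∧
    ∀ i, ∀ x ∈ S i, P x (S (i + 1)) = 1

/-- `P` is aperiodic: it is not periodic with any period `d ≥ 2`. -/
def IsAperiodic (P : Kernel 𝒳 𝒳) (π : Measure 𝒳) : Prop :=
  ∀ d : ℕ, ¬ IsPeriodicWith P π d

/-- The operator of the kernel `P`: `(𝒫 f)(x) = ∫ f(y) P(x, dy)`. -/
noncomputable def kernelOp (P : Kernel 𝒳 𝒳) (f : 𝒳 → ℝ) : 𝒳 → ℝ :=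
  fun x => ∫ y, f y ∂(P x)

/-- The inner product `⟨f, g⟩ = ∫ f g dπ` of `L²(π)`. -/
noncomputable def l2Inner (π : Measure 𝒳) (f g : 𝒳 → ℝ) : ℝ :=
  ∫ x, f x * g x ∂π

/-- The norm `‖f‖ = √⟨f, f⟩` of `L²(π)`. -/
noncomputable def l2Norm (π : Measure 𝒳) (f : 𝒳 → ℝ) : ℝ :=
  √(l2Inner π f f)

/-- The law, on the space of trajectories `ℕ → 𝒳`, of the Markov chain `X 0, X 1, X 2, …` with
kernel `P` and initial distribution `X 0 ∼ π`: given `X 0, …, X n`, the next state `X (n + 1)` has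
distribution `P (X n)`. The chain itself is given by the coordinates, `X k ω = ω k`. -/
noncomputable def chainLaw (P : Kernel 𝒳 𝒳) [IsMarkovKernel P] (π : Measure 𝒳) :
    Measure (ℕ → 𝒳) :=
  Kernel.trajMeasure (X := fun _ : ℕ => 𝒳) π fun n =>
    P.comap (fun h : (i : Finset.Iic n) → 𝒳 => h ⟨n, Finset.mem_Iic.2 le_rfl⟩)
      (measurable_pi_apply _)

/-- The lag-`k` autocovariance `γ k = Cov(f(X 0), f(X k))` of the chain started from `π`. -/
noncomputable def autocov (P : Kernel 𝒳 𝒳) [IsMarkovKernel P] (π : Measure 𝒳) (f : 𝒳 → ℝ)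
    (k : ℕ) : ℝ :=
  cov[fun ω : ℕ → 𝒳 => f (ω 0), fun ω : ℕ → 𝒳 => f (ω k); chainLaw P π]

/-- `v` is the asymptotic variance `v(f, P) = lim_N (1/N) Var(f(X_1) + … + f(X_N))` of the chain
started from `π`: the limit exists in the extended reals and equals `v`. The first `N` states of
the chain are here numbered `0, …, N - 1`. -/
def HasAsymptoticVariance (P : Kernel 𝒳 𝒳) [IsMarkovKernel P] (π : Measure 𝒳) (f : 𝒳 → ℝ)
    (v : EReal) : Prop :=
  Tendsto
    (fun N : ℕ =>
      (((1 / (N : ℝ)) *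
        Var[fun ω : ℕ → 𝒳 => ∑ k ∈ Finset.range N, f (ω k); chainLaw P π] : ℝ) : EReal))
    atTop (𝓝 v)

/-- `s` is the sum `∑_{k ≥ 1} a k` of a real series: its partial sums converge to `s` in the
extended reals (no absolute convergence is asked for). -/
def HasSeriesSum (a : ℕ → ℝ) (s : EReal) : Prop :=
  Tendsto (fun n : ℕ => ((∑ k ∈ Finset.Icc 1 n, a k : ℝ) : EReal)) atTop (𝓝 s)

end ReversibleChain

/-! ### Real series and Cesàro means. -/

namespace ReversibleChain

/-! Put a_k = ⟨f, 𝒫^k f⟩. By stationarity and the Markov property, f(X_i) and f(X_{i+k}) have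
covariance a_k, so the variance of N terms is the sum over n < N of a_0 + 2(a_1 + … + a_n)
(`variance_sum_eval`). The normalised variance is thus a Cesàro mean, and it remains to show that
the partial sums of a_k converge in the extended reals.

No spectral theorem is needed. Reversibility makes 𝒫 a symmetric contraction of L²(π), so a_{2k} =
‖𝒫^k f‖² ≥ 0 and a_{2k} + a_{2k+1} ≥ 0. Partial sums with an even number of terms therefore
increase, and those with an odd number have the same limit once a_{2k} → 0.

For the latter, 𝒫^{2k} f converges to some G of mean zero with 𝒫²G = G
(`exists_tendsto_iterate_even`). Such a G vanishes (`eq_zero_of_l2Op_l2Op_eq`): an eigenfunction for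
±1 is preserved, up to that sign, along almost every transition, so the set where it is positive
would be invariant (excluded by irreducibility) or exchanged with the set where it is negative
(excluded by aperiodicity). -/

theorem tendsto_of_tendsto_even_odd {α : Type*} {u : ℕ → α} {l : Filter α}
    (he : Tendsto (fun m => u (2 * m)) atTop l) (ho : Tendsto (fun m => u (2 * m + 1)) atTop l) :
    Tendsto u atTop l := by
  intro s hs
  obtain ⟨M, hM⟩ := eventually_atTop.1 (he hs)
  obtain ⟨M', hM'⟩ := eventually_atTop.1 (ho hs)
  refine eventually_atTop.2 ⟨2 * M + 2 * M' + 1, fun n hn => ?_⟩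
  obtain ⟨k, rfl | rfl⟩ := Nat.even_or_odd' n
  · exact hM k (by omega)
  · exact hM' k (by omega)

/-- Truncating at b + 1 gives a convergent sequence, whose Cesàro means eventually exceed b and lie
below those of u. -/
theorem tendsto_cesaro_atTop {u : ℕ → ℝ} (hu : Tendsto u atTop atTop) :
    Tendsto (fun N : ℕ => (N : ℝ)⁻¹ * ∑ n ∈ Finset.range N, u n) atTop atTop := by
  refine tendsto_atTop.2 fun b => ?_
  have h1 : Tendsto (fun n => min (u n) (b + 1)) atTop (𝓝 (b + 1)) := by
    refine tendsto_const_nhds.congr' ?_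
    filter_upwards [hu.eventually_ge_atTop (b + 1)] with n hn
    exact (min_eq_right hn).symm
  filter_upwards [h1.cesaro.eventually_const_le (by linarith : b < b + 1)] with N hN
  refine hN.trans ?_
  gcongr
  exact min_le_left _ _

theorem sum_Icc_one_eq (a : ℕ → ℝ) (n : ℕ) :
    ∑ k ∈ Finset.Icc 1 n, a k = ∑ k ∈ Finset.range (n + 1), a k - a 0 := by
  rw [Finset.range_eq_Ico, Finset.sum_eq_sum_Ico_succ_bot (by omega)]
  simp only [zero_add, add_sub_cancel_left]
  rfl

/-- Partial sums of a series whose consecutive pairs are nonnegative and whose terms of even index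
are nonnegative and tend to zero converge to a real number or to infinity. -/
theorem tendsto_sum_range_of_pairs_nonneg {a : ℕ → ℝ} (hpair : ∀ k, 0 ≤ a (2 * k) + a (2 * k + 1))
    (heven : ∀ k, 0 ≤ a (2 * k)) (hlim : Tendsto (fun k => a (2 * k)) atTop (𝓝 0)) :
    Tendsto (fun n => ∑ k ∈ Finset.range n, a k) atTop atTop ∨
      ∃ l : ℝ, Tendsto (fun n => ∑ k ∈ Finset.range n, a k) atTop (𝓝 l) := by
  have hmono : Monotone fun m => ∑ k ∈ Finset.range (2 * m), a k := by
    refine monotone_nat_of_le_succ fun m => ?_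
    rw [show 2 * (m + 1) = 2 * m + 1 + 1 by ring, Finset.sum_range_succ, Finset.sum_range_succ]
    linarith [hpair m]
  rcases tendsto_atTop_of_monotone hmono with h | ⟨l, h⟩
  · refine Or.inl (tendsto_of_tendsto_even_odd h ?_)
    refine tendsto_atTop_mono (fun m => ?_) h
    rw [Finset.sum_range_succ]
    linarith [heven m]
  · refine Or.inr ⟨l, tendsto_of_tendsto_even_odd h ?_⟩
    simp only [Finset.sum_range_succ]
    simpa using h.add hlim

theorem exists_hasSeriesSum_and_tendsto_cesaro {a : ℕ → ℝ}
    (hpair : ∀ k, 0 ≤ a (2 * k) + a (2 * k + 1))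
    (heven : ∀ k, 0 ≤ a (2 * k)) (hlim : Tendsto (fun k => a (2 * k)) atTop (𝓝 0)) :
    ∃ s : EReal, HasSeriesSum a s ∧
      Tendsto (fun N : ℕ => (((N : ℝ)⁻¹ *
        ∑ n ∈ Finset.range N, (a 0 + 2 * ∑ k ∈ Finset.Icc 1 n, a k) : ℝ) : EReal)) atTop
        (𝓝 ((a 0 : EReal) + 2 * s)) := by
  rcases tendsto_sum_range_of_pairs_nonneg hpair heven hlim with h | ⟨l, h⟩
  · have h1 : Tendsto (fun n => ∑ k ∈ Finset.Icc 1 n, a k) atTop atTop := by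
      simp only [sum_Icc_one_eq, sub_eq_add_neg]
      exact tendsto_atTop_add_const_right _ _ (h.comp (tendsto_add_atTop_nat 1))
    refine ⟨⊤, EReal.tendsto_coe_atTop.comp h1, ?_⟩
    have h2 : ((a 0 : ℝ) : EReal) + 2 * ⊤ = ⊤ := by
      rw [EReal.mul_top_of_pos (by norm_num), EReal.coe_add_top]
    rw [h2]
    exact EReal.tendsto_coe_atTop.comp (tendsto_cesaro_atTop
      (tendsto_atTop_add_const_left _ _ (h1.const_mul_atTop two_pos)))
  · have h1 : Tendsto (fun n => ∑ k ∈ Finset.Icc 1 n, a k) atTop (𝓝 (l - a 0)) := by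
      simp only [sum_Icc_one_eq]
      exact (h.comp (tendsto_add_atTop_nat 1)).sub_const _
    refine ⟨((l - a 0 : ℝ) : EReal), (continuous_coe_real_ereal.tendsto _).comp h1, ?_⟩
    have h2 : ((a 0 : ℝ) : EReal) + 2 * ((l - a 0 : ℝ) : EReal) =
        ((a 0 + 2 * (l - a 0) : ℝ) : EReal) := by
      push_cast; rfl
    rw [h2]
    exact (continuous_coe_real_ereal.tendsto _).comp ((h1.const_mul 2).const_add (a 0)).cesaro

/-! ### Symmetric contractions of a Hilbert space. -/

section Hilbert

open scoped InnerProductSpace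

variable {H : Type*} [NormedAddCommGroup H] [InnerProductSpace ℝ H]

theorem inner_iterate_iterate {T : H → H} (hT : ∀ x y, ⟪T x, y⟫_ℝ = ⟪x, T y⟫_ℝ) (x : H)
    (i j : ℕ) : ⟪T^[i] x, T^[j] x⟫_ℝ = ⟪x, T^[i + j] x⟫_ℝ := by
  induction i generalizing j with
  | zero => simp
  | succ i ih =>
    rw [Function.iterate_succ_apply', hT, ← Function.iterate_succ_apply' T, ih]
    congr 2; omega

theorem inner_iterate_even_nonneg {T : H → H} (hT : ∀ x y, ⟪T x, y⟫_ℝ = ⟪x, T y⟫_ℝ) (x : H)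
    (k : ℕ) : 0 ≤ ⟪x, T^[2 * k] x⟫_ℝ := by
  rw [two_mul, ← inner_iterate_iterate hT]
  exact real_inner_self_nonneg

/-- With y = T^k x the sum is ‖y‖² + ⟨y, T y⟩, and Cauchy–Schwarz with contraction gives ⟨y, T y⟩ ≥
-‖y‖². -/
theorem inner_iterate_pair_nonneg {T : H → H} (hT : ∀ x y, ⟪T x, y⟫_ℝ = ⟪x, T y⟫_ℝ)
    (hc : ∀ x, ‖T x‖ ≤ ‖x‖) (x : H) (k : ℕ) :
    0 ≤ ⟪x, T^[2 * k] x⟫_ℝ + ⟪x, T^[2 * k + 1] x⟫_ℝ := by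
  rw [show 2 * k + 1 = k + (k + 1) by ring, two_mul, ← inner_iterate_iterate hT,
    ← inner_iterate_iterate hT, Function.iterate_succ_apply', real_inner_self_eq_norm_sq]
  have h1 := neg_le_of_abs_le (abs_real_inner_le_norm (T^[k] x) (T (T^[k] x)))
  nlinarith [hc (T^[k] x), norm_nonneg (T^[k] x)]

/-- The even iterates of a symmetric contraction converge to a fixed vector of its square. -/
theorem exists_tendsto_iterate_even [CompleteSpace H] {T : H →L[ℝ] H}
    (hT : ∀ x y, ⟪T x, y⟫_ℝ = ⟪x, T y⟫_ℝ) (hc : ∀ x, ‖T x‖ ≤ ‖x‖) (x : H) :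
    ∃ g, T (T g) = g ∧ Tendsto (fun m => T^[2 * m] x) atTop (𝓝 g) := by
  set b : ℕ → ℝ := fun m => ⟪x, T^[2 * m] x⟫_ℝ with hb
  have hb_sq (m : ℕ) : b m = ‖T^[m] x‖ ^ 2 := by
    rw [← real_inner_self_eq_norm_sq, inner_iterate_iterate hT, ← two_mul]
  have hanti : Antitone b := by
    refine antitone_nat_of_succ_le fun m => ?_
    rw [hb_sq, hb_sq, Function.iterate_succ_apply']
    gcongr
    exact hc _
  obtain ⟨c, hbc⟩ : ∃ c, Tendsto b atTop (𝓝 c) :=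
    ⟨_, tendsto_atTop_ciInf hanti ⟨0, by
      rintro _ ⟨m, rfl⟩
      exact inner_iterate_even_nonneg hT x m⟩⟩
  -- Symmetry expresses all distances through the convergent sequence b, which yields the Cauchy
  -- property.
  have hdist (m n : ℕ) :
      ‖T^[2 * m] x - T^[2 * n] x‖ ^ 2 = b (2 * m) + b (2 * n) - 2 * b (m + n) := by
    rw [norm_sub_sq_real, hb_sq, hb_sq, inner_iterate_iterate hT, ← mul_add]
    ring
  have hcau : CauchySeq fun m => T^[2 * m] x := by
    refine Metric.cauchySeq_iff.2 fun ε hε => ?_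
    -- The limit c cancels in `hdist`; the errors, of total weight 1 + 1 + 2, leave less than ε ^ 2.
    obtain ⟨N, hN⟩ := Metric.tendsto_atTop.1 hbc (ε ^ 2 / 4) (by positivity)
    refine ⟨N, fun m hm n hn => ?_⟩
    rw [dist_eq_norm]
    refine lt_of_pow_lt_pow_left₀ 2 hε.le ?_
    rw [hdist]
    have h1 := abs_lt.1 (hN (2 * m) (by omega))
    have h2 := abs_lt.1 (hN (2 * n) (by omega))
    have h3 := abs_lt.1 (hN (m + n) (by omega))
    linarith [h1.2, h2.2, h3.1]
  obtain ⟨g, hg⟩ := cauchySeq_tendsto_of_complete hcau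
  refine ⟨g, tendsto_nhds_unique ?_ (hg.comp (tendsto_add_atTop_nat 1)), hg⟩
  refine (((T.continuous.comp T.continuous).tendsto g).comp hg).congr fun m => ?_
  simp only [Function.comp_apply]
  rw [show 2 * (m + 1) = 2 * m + 1 + 1 by ring, Function.iterate_succ_apply',
    Function.iterate_succ_apply']

end Hilbert

end ReversibleChain

/-! ### The kernel on functions, and invariant sets. -/

namespace ReversibleChain
open scoped InnerProductSpace ENNReal

variable {𝒳 : Type*} [MeasurableSpace 𝒳] {π : Measure 𝒳} {P : Kernel 𝒳 𝒳}

/-- By invariance, a π-null set is P(x, ·)-null for almost every x, so the operator acts on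
almost-everywhere classes. -/
theorem kernelOp_congr (hinv : P.Invariant π) {f g : 𝒳 → ℝ} (h : f =ᵐ[π] g) :
    kernelOp P f =ᵐ[π] kernelOp P g := by
  rw [← hinv.def] at h
  filter_upwards [Measure.ae_ae_of_ae_comp h] with x hx
  exact integral_congr_ae hx

theorem ae_aestronglyMeasurable (hinv : P.Invariant π) {f : 𝒳 → ℝ}
    (hf : AEStronglyMeasurable f π) : ∀ᵐ x ∂π, AEStronglyMeasurable f (P x) := by
  have h := hf.ae_eq_mk
  nth_rw 1 [← hinv.def] at h
  filter_upwards [Measure.ae_ae_of_ae_comp h] with x hx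
  exact ⟨_, hf.stronglyMeasurable_mk, hx⟩

theorem aestronglyMeasurable_kernelOp (hinv : P.Invariant π) {f : 𝒳 → ℝ}
    (hf : AEStronglyMeasurable f π) : AEStronglyMeasurable (kernelOp P f) π :=
  ⟨kernelOp P (hf.mk f), hf.stronglyMeasurable_mk.integral_kernel,
    kernelOp_congr hinv hf.ae_eq_mk⟩

/-- A null set is contained in a null set whose complement is absorbing. -/
theorem exists_null_superset_absorbing (hinv : P.Invariant π) {A : Set 𝒳} (hA : π A = 0) :
    ∃ N, A ⊆ N ∧ MeasurableSet N ∧ π N = 0 ∧ ∀ x, x ∉ N → P x N = 0 := by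
  have step (B : Set 𝒳) (hB : MeasurableSet B) (hB0 : π B = 0) :
      MeasurableSet {x | P x B ≠ 0} ∧ π {x | P x B ≠ 0} = 0 := by
    refine ⟨(P.measurable_coe hB) (measurableSet_singleton 0).compl, ?_⟩
    have h : (π.bind P) B = 0 := by rw [hinv.def, hB0]
    rw [Measure.bind_apply hB P.aemeasurable, lintegral_eq_zero_iff (P.measurable_coe hB)] at h
    exact h
  -- S (n + 1) is the set of states that enter S n in one step with positive probability; the union
  -- of all S n then has absorbing complement.
  let S : ℕ → Set 𝒳 := fun n => Nat.rec (toMeasurable π A) (fun _ B => {x | P x B ≠ 0}) n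
  have hS (n : ℕ) : MeasurableSet (S n) ∧ π (S n) = 0 := by
    induction n with
    | zero => exact ⟨measurableSet_toMeasurable _ _, by simpa [S] using hA⟩
    | succ n ih => exact step _ ih.1 ih.2
  refine ⟨⋃ n, S n, (subset_toMeasurable π A).trans (Set.subset_iUnion S 0),
    .iUnion fun n => (hS n).1, measure_iUnion_null fun n => (hS n).2, fun x hx => ?_⟩
  refine measure_iUnion_null fun n => ?_
  by_contra hne
  exact hx (Set.mem_iUnion.2 ⟨n + 1, hne⟩)

theorem pow_apply_compl_eq_zero {C : Set 𝒳} (hC : MeasurableSet C)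
    (h : ∀ x ∈ C, P x Cᶜ = 0) (n : ℕ) {x : 𝒳} (hx : x ∈ C) : (P ^ n) x Cᶜ = 0 := by
  induction n generalizing x with
  | zero =>
    rw [pow_zero, show (1 : Kernel 𝒳 𝒳) = Kernel.id from rfl, Kernel.id_apply,
      Measure.dirac_apply' _ hC.compl]
    simp [hx]
  | succ n ih =>
    rw [Kernel.pow_succ_apply_eq_lintegral _ _ _ hC.compl,
      lintegral_eq_zero_iff (P.measurable_coe hC.compl)]
    filter_upwards [mem_ae_iff.2 (ih hx)] with y hy
    exact h y hy

/-- An invariant set of an irreducible chain is null or conull. -/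
theorem measure_eq_zero_or_compl_eq_zero (hinv : P.Invariant π) (hirr : IsPhiIrreducible P)
    {A : Set 𝒳} (hA : MeasurableSet A) (h1 : ∀ᵐ x ∂π, x ∈ A → P x Aᶜ = 0)
    (h2 : ∀ᵐ x ∂π, x ∉ A → P x A = 0) : π A = 0 ∨ π Aᶜ = 0 := by
  obtain ⟨φ, -, hφ0, hφ⟩ := hirr
  obtain ⟨N, hN, hNm, hN0, hNabs⟩ := exists_null_superset_absorbing hinv
    (A := {x | ¬ ((x ∈ A → P x Aᶜ = 0) ∧ (x ∉ A → P x A = 0))}) (h1.and h2)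
  have hgood (x : 𝒳) (hx : x ∉ N) : (x ∈ A → P x Aᶜ = 0) ∧ (x ∉ A → P x A = 0) := by
    by_contra hc
    exact hx (hN hc)
  -- B \ N is absorbing and nonempty, so its complement is unreachable from one of its points and
  -- must be φ-null. For A and its complement both to be non-null would force φ = 0.
  have key (B : Set 𝒳) (hB : MeasurableSet B) (hBN : ∀ x ∈ B, x ∉ N → P x Bᶜ = 0)
      (hB0 : π B ≠ 0) : φ (B \ N)ᶜ = 0 := by
    obtain ⟨x, hx⟩ : (B \ N).Nonempty :=
      nonempty_of_measure_ne_zero (μ := π) (by rwa [measure_sdiff_null hN0])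
    by_contra hne
    obtain ⟨n, hn⟩ := hφ.irreducible (hB.diff hNm).compl (pos_iff_ne_zero.2 hne) x
    refine hn.ne' (pow_apply_compl_eq_zero (hB.diff hNm) (fun y hy => ?_) n hx)
    rw [Set.sdiff_eq, Set.compl_inter, compl_compl]
    exact measure_union_null (hBN y hy.1 hy.2) (hNabs y hy.2)
  by_contra! hcon
  refine hφ0 (Measure.measure_univ_eq_zero.1 (measure_mono_null ?_ (measure_union_null
    (key A hA (fun x hx hxN => (hgood x hxN).1 hx) hcon.1)
    (key Aᶜ hA.compl (fun x hx hxN => by simpa using (hgood x hxN).2 hx) hcon.2))))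
  intro x _
  by_cases hx : x ∈ A <;> simp [hx]

theorem ae_eq_zero_of_ae_nonpos_of_integral_eq_zero {f : 𝒳 → ℝ} (hf : Integrable f π)
    (h : ∀ᵐ x ∂π, f x ≤ 0) (h0 : ∫ x, f x ∂π = 0) : f =ᵐ[π] 0 := by
  have := (integral_eq_zero_iff_of_nonneg_ae (f := fun x => - f x)
    (h.mono fun x hx => by simpa using hx) hf.neg).1 (by rw [integral_neg, h0, neg_zero])
  exact this.mono fun x hx => by simpa using hx

variable [IsMarkovKernel P]

/-- Jensen's inequality under each probability P(x, ·), here as monotonicity of the Lᵖ norm in p,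
then integration using invariance. -/
theorem eLpNorm_kernelOp_le (hinv : P.Invariant π) {f : 𝒳 → ℝ}
    (hf : AEStronglyMeasurable f π) : eLpNorm (kernelOp P f) 2 π ≤ eLpNorm f 2 π := by
  rw [eLpNorm_eq_lintegral_rpow_enorm_toReal (by norm_num) (by norm_num),
    eLpNorm_eq_lintegral_rpow_enorm_toReal (by norm_num) (by norm_num)]
  gcongr ?_ ^ _
  have h1 : ∫⁻ x, ‖f x‖ₑ ^ (2 : ℝ≥0∞).toReal ∂π =
      ∫⁻ x, ∫⁻ y, ‖f y‖ₑ ^ (2 : ℝ≥0∞).toReal ∂(P x) ∂π := by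
    conv_lhs => rw [← hinv.def]
    refine Measure.lintegral_bind P.aemeasurable ?_
    rw [hinv.def]
    exact hf.enorm.pow_const _
  rw [h1]
  refine lintegral_mono_ae ?_
  filter_upwards [ae_aestronglyMeasurable hinv hf] with x hx
  calc ‖kernelOp P f x‖ₑ ^ (2 : ℝ≥0∞).toReal
      ≤ (eLpNorm f 2 (P x)) ^ (2 : ℝ≥0∞).toReal := by
        gcongr
        refine (enorm_integral_le_lintegral_enorm _).trans ?_
        rw [← eLpNorm_one_eq_lintegral_enorm]
        exact eLpNorm_le_eLpNorm_of_exponent_le (by norm_num) hx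
    _ = ∫⁻ y, ‖f y‖ₑ ^ (2 : ℝ≥0∞).toReal ∂(P x) := by
        rw [eLpNorm_eq_lintegral_rpow_enorm_toReal (by norm_num) (by norm_num),
          ← ENNReal.rpow_mul]
        norm_num

theorem memLp_kernelOp (hinv : P.Invariant π) {f : 𝒳 → ℝ} (hf : MemLp f 2 π) :
    MemLp (kernelOp P f) 2 π :=
  ⟨aestronglyMeasurable_kernelOp hinv hf.1, (eLpNorm_kernelOp_le hinv hf.1).trans_lt hf.2⟩

theorem memLp_kernelOp_iterate (hinv : P.Invariant π) {f : 𝒳 → ℝ} (hf : MemLp f 2 π) (k : ℕ) :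
    MemLp ((kernelOp P)^[k] f) 2 π := by
  induction k with
  | zero => exact hf
  | succ k ih =>
    rw [Function.iterate_succ_apply']
    exact memLp_kernelOp hinv ih

variable [IsProbabilityMeasure π]

/-! ### The law π ⊗ P of one transition, and eigenfunctions for ±1. -/

section Edge

theorem map_swap_compProd (hrev : P.IsReversible π) : (π ⊗ₘ P).map Prod.swap = π ⊗ₘ P := by
  have : IsProbabilityMeasure ((π ⊗ₘ P).map Prod.swap) :=
    Measure.isProbabilityMeasure_map measurable_swap.aemeasurable
  refine Measure.ext_prod fun {s t} hs ht => ?_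
  rw [Measure.map_apply measurable_swap (hs.prod ht), Set.preimage_swap_prod,
    Measure.compProd_apply_prod ht hs, Measure.compProd_apply_prod hs ht]
  exact hrev ht hs

theorem measurePreserving_fst_compProd : MeasurePreserving Prod.fst (π ⊗ₘ P) π :=
  ⟨measurable_fst, Measure.fst_compProd π P⟩

theorem measurePreserving_snd_compProd (hinv : P.Invariant π) :
    MeasurePreserving Prod.snd (π ⊗ₘ P) π :=
  ⟨measurable_snd, (Measure.snd_compProd π P).trans hinv.def⟩

theorem integral_mul_kernelOp (hinv : P.Invariant π) {f g : 𝒳 → ℝ} (hf : MemLp f 2 π)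
    (hg : MemLp g 2 π) :
    ∫ x, f x * kernelOp P g x ∂π = ∫ p : 𝒳 × 𝒳, f p.1 * g p.2 ∂(π ⊗ₘ P) := by
  rw [Measure.integral_compProd]
  · simp only [integral_const_mul, kernelOp]
  · exact (hf.comp_measurePreserving measurePreserving_fst_compProd).integrable_mul
      (hg.comp_measurePreserving (measurePreserving_snd_compProd hinv))

theorem integral_kernelOp_mul (hrev : P.IsReversible π) {f g : 𝒳 → ℝ} (hf : MemLp f 2 π)
    (hg : MemLp g 2 π) :
    ∫ x, kernelOp P f x * g x ∂π = ∫ x, f x * kernelOp P g x ∂π := by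
  have h := integral_mul_kernelOp hrev.invariant hg hf
  simp only [mul_comm (kernelOp P f _)]
  have hm : MeasurePreserving (MeasurableEquiv.prodComm : 𝒳 × 𝒳 ≃ᵐ 𝒳 × 𝒳) (π ⊗ₘ P) (π ⊗ₘ P) :=
    ⟨measurable_swap, map_swap_compProd hrev⟩
  rw [h, integral_mul_kernelOp hrev.invariant hf hg,
    ← hm.integral_comp' (fun p : 𝒳 × 𝒳 => f p.1 * g p.2)]
  exact integral_congr_ae (ae_of_all _ fun p => mul_comm _ _)

/-- The integrand is (f x - c f y)² expanded, so this is a Dirichlet form identity. -/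
theorem integral_sq_edge (hinv : P.Invariant π) {f : 𝒳 → ℝ} (hf : MemLp f 2 π) (c : ℝ) :
    ∫ p : 𝒳 × 𝒳, f p.1 * f p.1 - 2 * c * (f p.1 * f p.2) +
      c ^ 2 * (f p.2 * f p.2) ∂(π ⊗ₘ P) =
      (1 + c ^ 2) * ∫ x, f x * f x ∂π - 2 * c * ∫ x, f x * kernelOp P f x ∂π := by
  have h1 := hf.comp_measurePreserving (measurePreserving_fst_compProd (P := P))
  have h2 := hf.comp_measurePreserving (measurePreserving_snd_compProd hinv)
  have i11 : Integrable (fun p : 𝒳 × 𝒳 => f p.1 * f p.1) (π ⊗ₘ P) := h1.integrable_mul h1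
  have i12 : Integrable (fun p : 𝒳 × 𝒳 => f p.1 * f p.2) (π ⊗ₘ P) := h1.integrable_mul h2
  have i22 : Integrable (fun p : 𝒳 × 𝒳 => f p.2 * f p.2) (π ⊗ₘ P) := h2.integrable_mul h2
  have e1 : ∫ p : 𝒳 × 𝒳, f p.1 * f p.1 ∂(π ⊗ₘ P) = ∫ x, f x * f x ∂π := by
    have hm := measurePreserving_fst_compProd (π := π) (P := P)
    conv_rhs => rw [← hm.map_eq]
    rw [integral_map measurable_fst.aemeasurable]
    rw [hm.map_eq]
    exact hf.1.mul hf.1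
  have e2 : ∫ p : 𝒳 × 𝒳, f p.2 * f p.2 ∂(π ⊗ₘ P) = ∫ x, f x * f x ∂π := by
    have hm := measurePreserving_snd_compProd hinv
    conv_rhs => rw [← hm.map_eq]
    rw [integral_map measurable_snd.aemeasurable]
    rw [hm.map_eq]
    exact hf.1.mul hf.1
  have i : Integrable (fun p : 𝒳 × 𝒳 => f p.1 * f p.1 - 2 * c * (f p.1 * f p.2)) (π ⊗ₘ P) :=
    i11.sub (i12.const_mul _)
  rw [integral_add i (i22.const_mul _),
    integral_sub i11 (i12.const_mul _), integral_const_mul, integral_const_mul, e1, e2,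
    integral_mul_kernelOp hinv hf hf]
  ring

/-- An eigenfunction with eigenvalue `c = ±1` satisfies `f x = c * f y` for almost every
transition from `x` to `y`. -/
theorem ae_ae_eq_mul_of_kernelOp_eq_mul (hinv : P.Invariant π) {f : 𝒳 → ℝ} (hf : MemLp f 2 π)
    {c : ℝ} (hc : c ^ 2 = 1) (h : kernelOp P f =ᵐ[π] fun x => c * f x) :
    ∀ᵐ x ∂π, ∀ᵐ y ∂(P x), f x = c * f y := by
  have h1 := hf.comp_measurePreserving (measurePreserving_fst_compProd (P := P))
  have h2 := hf.comp_measurePreserving (measurePreserving_snd_compProd hinv)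
  have hint : Integrable (fun p : 𝒳 × 𝒳 => f p.1 * f p.1 - 2 * c * (f p.1 * f p.2) +
      c ^ 2 * (f p.2 * f p.2)) (π ⊗ₘ P) :=
    ((h1.integrable_mul h1).sub ((h1.integrable_mul h2).const_mul _)).add
      ((h2.integrable_mul h2).const_mul _)
  have hsq (p : 𝒳 × 𝒳) : f p.1 * f p.1 - 2 * c * (f p.1 * f p.2) + c ^ 2 * (f p.2 * f p.2) =
      (f p.1 - c * f p.2) ^ 2 := by ring
  have h0 := integral_sq_edge hinv hf c
  have h3 : ∫ x, f x * kernelOp P f x ∂π = c * ∫ x, f x * f x ∂π := by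
    rw [← integral_const_mul]
    refine integral_congr_ae (h.mono fun x hx => ?_)
    simp only [hx]
    ring
  -- For an eigenfunction the Dirichlet form is (1 - c²)‖f‖² = 0, so the square vanishes almost
  -- everywhere.
  rw [h3, show (1 + c ^ 2) * ∫ x, f x * f x ∂π - 2 * c * (c * ∫ x, f x * f x ∂π) =
    (1 - c ^ 2) * ∫ x, f x * f x ∂π by ring, sub_eq_zero.2 hc.symm, zero_mul,
    integral_eq_zero_iff_of_nonneg (fun p => (hsq p).symm ▸ sq_nonneg (f p.1 - c * f p.2)) hint] at h0
  filter_upwards [Measure.ae_ae_of_ae_compProd h0] with x hx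
  filter_upwards [hx] with y hy
  have := (hsq (x, y)).symm.trans hy
  exact sub_eq_zero.1 (pow_eq_zero_iff two_ne_zero |>.1 this)

end Edge

/-- An irreducible chain has no harmonic functions of mean zero. -/
theorem ae_eq_zero_of_harmonic (hinv : P.Invariant π) (hirr : IsPhiIrreducible P)
    {f : 𝒳 → ℝ} (hfm : Measurable f) (hf : MemLp f 2 π) (hf0 : ∫ x, f x ∂π = 0)
    (h : kernelOp P f =ᵐ[π] f) : f =ᵐ[π] 0 := by
  have hae := ae_ae_eq_mul_of_kernelOp_eq_mul hinv hf (one_pow 2) (by simpa using h)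
  have hint := hf.integrable (by norm_num)
  have hA : MeasurableSet {x | 0 < f x} := measurableSet_lt measurable_const hfm
  -- The set {f > 0} is invariant, so f has constant sign almost everywhere, and mean zero forces f
  -- = 0.
  rcases measure_eq_zero_or_compl_eq_zero hinv hirr hA
    (hae.mono fun x hx (hpos : 0 < f x) => by
      refine mem_ae_iff.1 (hx.mono fun y hy => ?_)
      show 0 < f y
      linarith)
    (hae.mono fun x hx (hneg : ¬ 0 < f x) => by
      refine (measure_eq_zero_iff_ae_notMem).2 (hx.mono fun y hy => ?_)
      show ¬ 0 < f y
      rwa [← one_mul (f y), ← hy]) with h0 | h0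
  · refine ae_eq_zero_of_ae_nonpos_of_integral_eq_zero hint ?_ hf0
    exact (measure_eq_zero_iff_ae_notMem.1 h0).mono fun x hx => not_lt.1 hx
  · have := ae_eq_zero_of_ae_nonpos_of_integral_eq_zero hint.neg
      ((mem_ae_iff.2 h0 : {x | 0 < f x} ∈ ae π) |> Filter.Eventually.mono <|
        fun x (hx : 0 < f x) => by simpa using hx.le) (by simp [integral_neg, hf0])
    exact this.mono fun x hx => by simpa using hx

/-- An aperiodic chain has no eigenfunctions of mean zero with eigenvalue `-1`. -/
theorem ae_eq_zero_of_kernelOp_eq_neg (hinv : P.Invariant π) (haper : IsAperiodic P π)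
    {f : 𝒳 → ℝ} (hfm : Measurable f) (hf : MemLp f 2 π) (hf0 : ∫ x, f x ∂π = 0)
    (h : kernelOp P f =ᵐ[π] fun x => - f x) : f =ᵐ[π] 0 := by
  have hae := ae_ae_eq_mul_of_kernelOp_eq_mul hinv hf (c := -1) (by norm_num) (by simpa using h)
  have hint := hf.integrable (by norm_num)
  by_cases hpos : π {x | 0 < f x} = 0
  · refine ae_eq_zero_of_ae_nonpos_of_integral_eq_zero hint ?_ hf0
    exact (measure_eq_zero_iff_ae_notMem.1 hpos).mono fun x hx => not_lt.1 hx
  by_cases hneg : π {x | f x < 0} = 0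
  · have := ae_eq_zero_of_ae_nonpos_of_integral_eq_zero hint.neg
      ((measure_eq_zero_iff_ae_notMem.1 hneg).mono fun x hx => by simpa using hx)
      (by simp [integral_neg, hf0])
    exact this.mono fun x hx => by simpa using hx
  exfalso
  -- Periodicity constrains every point of the cyclic sets. Removing a null set with absorbing
  -- complement makes the sign change hold at every remaining state, so the two sign sets form a
  -- cycle of period 2.
  obtain ⟨N, hN, hNm, hN0, hNabs⟩ := exists_null_superset_absorbing hinv
    (A := {x | ¬ ∀ᵐ y ∂(P x), f x = -1 * f y}) hae
  have hgood (x : 𝒳) (hx : x ∉ N) : ∀ᵐ y ∂(P x), f x = -1 * f y ∧ y ∉ N := by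
    refine Eventually.and ?_ (measure_eq_zero_iff_ae_notMem.1 (hNabs x hx))
    by_contra hc
    exact hx (hN hc)
  have hpm : MeasurableSet {x | 0 < f x} := measurableSet_lt measurable_const hfm
  have hnm : MeasurableSet {x | f x < 0} := measurableSet_lt hfm measurable_const
  refine haper 2 ⟨le_rfl, fun i => if i = 0 then {x | 0 < f x} \ N else {x | f x < 0} \ N,
    fun i => ?_, fun i => ?_, fun i j hij => ?_, fun i x hx => ?_⟩
  · dsimp only
    split_ifs
    exacts [hpm.diff hNm, hnm.diff hNm]
  · dsimp only
    split_ifs <;> rw [measure_sdiff_null hN0]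
    exacts [pos_iff_ne_zero.2 hpos, pos_iff_ne_zero.2 hneg]
  · have hdis : Disjoint ({x | 0 < f x} \ N) ({x | f x < 0} \ N) :=
      Set.disjoint_left.2 fun x hx hx' => lt_asymm (show 0 < f x from hx.1) hx'.1
    fin_cases i <;> fin_cases j
    · exact absurd rfl hij
    · exact hdis
    · exact hdis.symm
    · exact absurd rfl hij
  · have key (B : Set 𝒳) (hB : ∀ y, f x = -1 * f y → y ∉ N → y ∈ B) (hx : x ∉ N) :
        P x B = 1 := by
      rw [← measure_univ (μ := P x)]
      refine measure_congr ?_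
      filter_upwards [hgood x hx] with y hy
      exact propext ⟨fun _ => trivial, fun _ => hB y hy.1 hy.2⟩
    fin_cases i
    · refine key ({x | f x < 0} \ N) (fun y hy hyN => ⟨?_, hyN⟩) hx.2
      have : 0 < f x := hx.1
      show f y < 0
      linarith
    · refine key ({x | 0 < f x} \ N) (fun y hy hyN => ⟨?_, hyN⟩) hx.2
      have : f x < 0 := hx.1
      show 0 < f y
      linarith

end ReversibleChain

namespace ReversibleChain
open scoped InnerProductSpace ENNReal

variable {𝒳 : Type*} [MeasurableSpace 𝒳] {π : Measure 𝒳} {P : Kernel 𝒳 𝒳}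

/-! ### The operator on L²(π), and decay of the even terms. -/

section L2

theorem ae_integrable_kernel (hinv : P.Invariant π) {f : 𝒳 → ℝ} (hf : Integrable f π) :
    ∀ᵐ x ∂π, Integrable f (P x) :=
  Measure.ae_integrable_of_integrable_comp (by rwa [hinv.def])

theorem kernelOp_add (hinv : P.Invariant π) {f g : 𝒳 → ℝ} (hf : Integrable f π)
    (hg : Integrable g π) :
    kernelOp P (f + g) =ᵐ[π] kernelOp P f + kernelOp P g := by
  filter_upwards [ae_integrable_kernel hinv hf, ae_integrable_kernel hinv hg] with x hfx hgx
  exact integral_add hfx hgx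

theorem kernelOp_smul (c : ℝ) (f : 𝒳 → ℝ) : kernelOp P (c • f) = c • kernelOp P f :=
  funext fun _ => integral_const_mul _ _

variable [IsMarkovKernel P] [IsProbabilityMeasure π]

theorem integral_kernelOp (hinv : P.Invariant π) {f : 𝒳 → ℝ} (hf : Integrable f π) :
    ∫ x, kernelOp P f x ∂π = ∫ x, f x ∂π := by
  have hm := measurePreserving_snd_compProd hinv
  have h := Measure.integral_compProd (hm.integrable_comp_of_integrable hf)
  conv_rhs => rw [← hm.map_eq]
  rw [integral_map hm.measurable.aemeasurable (by rw [hm.map_eq]; exact hf.1)]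
  exact h.symm

/-- The operator of an invariant Markov kernel on `L²(π)`. -/
noncomputable def l2Op (hinv : P.Invariant π) : Lp ℝ 2 π →L[ℝ] Lp ℝ 2 π :=
  LinearMap.mkContinuous
    { toFun := fun F => (memLp_kernelOp hinv (Lp.memLp F)).toLp
      map_add' := fun F G => by
        rw [← MemLp.toLp_add]
        refine MemLp.toLp_congr _ _ ((kernelOp_congr hinv (Lp.coeFn_add F G)).trans
          (kernelOp_add hinv ?_ ?_))
        exacts [(Lp.memLp F).integrable (by norm_num), (Lp.memLp G).integrable (by norm_num)]
      map_smul' := fun c F => by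
        rw [RingHom.id_apply, ← MemLp.toLp_const_smul]
        refine MemLp.toLp_congr _ _ ((kernelOp_congr hinv (Lp.coeFn_smul c F)).trans ?_)
        rw [kernelOp_smul] } 1 fun F => by
    rw [one_mul]
    change ‖(memLp_kernelOp hinv (Lp.memLp F)).toLp‖ ≤ ‖F‖
    refine (Lp.norm_toLp _ (memLp_kernelOp hinv (Lp.memLp F))).trans_le ?_
    exact ENNReal.toReal_mono (Lp.eLpNorm_ne_top F) (eLpNorm_kernelOp_le hinv (Lp.memLp F).1)

theorem l2Op_apply (hinv : P.Invariant π) (F : Lp ℝ 2 π) :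
    l2Op hinv F = (memLp_kernelOp hinv (Lp.memLp F)).toLp := rfl

theorem coeFn_l2Op (hinv : P.Invariant π) (F : Lp ℝ 2 π) :
    l2Op hinv F =ᵐ[π] kernelOp P F :=
  (memLp_kernelOp hinv (Lp.memLp F)).coeFn_toLp

theorem norm_l2Op_le (hinv : P.Invariant π) (F : Lp ℝ 2 π) : ‖l2Op hinv F‖ ≤ ‖F‖ := by
  refine (ContinuousLinearMap.le_of_opNorm_le _ (LinearMap.mkContinuous_norm_le _ zero_le_one _)
    F).trans ?_
  rw [one_mul]

theorem l2Op_symm (hrev : P.IsReversible π) (F G : Lp ℝ 2 π) :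
    ⟪l2Op hrev.invariant F, G⟫_ℝ = ⟪F, l2Op hrev.invariant G⟫_ℝ := by
  rw [L2.inner_def, L2.inner_def]
  have h := integral_kernelOp_mul hrev (Lp.memLp F) (Lp.memLp G)
  refine Eq.trans (integral_congr_ae ?_) (h.trans (integral_congr_ae ?_))
  · filter_upwards [coeFn_l2Op hrev.invariant F] with x hx
    rw [hx]
    exact mul_comm _ _
  · filter_upwards [coeFn_l2Op hrev.invariant G] with x hx
    rw [hx]
    exact mul_comm _ _

theorem l2Op_iterate_toLp (hinv : P.Invariant π) {f : 𝒳 → ℝ} (hf : MemLp f 2 π) (k : ℕ) :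
    (l2Op hinv)^[k] hf.toLp = (memLp_kernelOp_iterate hinv hf k).toLp := by
  induction k with
  | zero => rfl
  | succ k ih =>
    rw [Function.iterate_succ_apply', ih, l2Op_apply]
    refine MemLp.toLp_congr _ _ ?_
    rw [Function.iterate_succ_apply']
    exact kernelOp_congr hinv (MemLp.coeFn_toLp _)

theorem l2Inner_iterate_eq_inner (hinv : P.Invariant π) {f : 𝒳 → ℝ} (hf : MemLp f 2 π) (k : ℕ) :
    l2Inner π f ((kernelOp P)^[k] f) = ⟪hf.toLp, (l2Op hinv)^[k] hf.toLp⟫_ℝ := by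
  rw [l2Op_iterate_toLp, L2.inner_def]
  refine integral_congr_ae ?_
  filter_upwards [hf.coeFn_toLp, (memLp_kernelOp_iterate hinv hf k).coeFn_toLp] with x hx hy
  rw [hx, hy]
  exact mul_comm _ _

theorem integral_l2Op (hinv : P.Invariant π) (F : Lp ℝ 2 π) :
    ∫ x, l2Op hinv F x ∂π = ∫ x, F x ∂π :=
  (integral_congr_ae (coeFn_l2Op hinv F)).trans
    (integral_kernelOp hinv ((Lp.memLp F).integrable (by norm_num)))

theorem integral_iterate_l2Op (hinv : P.Invariant π) (F : Lp ℝ 2 π) (k : ℕ) :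
    ∫ x, ((l2Op hinv)^[k] F) x ∂π = ∫ x, F x ∂π := by
  induction k with
  | zero => rfl
  | succ k ih => rw [Function.iterate_succ_apply', integral_l2Op, ih]

/-- Integration against π is the inner product with the constant 1. -/
theorem continuous_integral_l2 : Continuous fun F : Lp ℝ 2 π => ∫ x, F x ∂π := by
  have h (F : Lp ℝ 2 π) :
      ∫ x, F x ∂π = ⟪(memLp_const (1 : ℝ) : MemLp (fun _ : 𝒳 => (1 : ℝ)) 2 π).toLp, F⟫_ℝ := by
    rw [L2.inner_def]
    refine integral_congr_ae ?_
    filter_upwards [(memLp_const (1 : ℝ) : MemLp (fun _ : 𝒳 => (1 : ℝ)) 2 π).coeFn_toLp]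
      with x hx
    rw [hx]
    simp
  simp only [h]
  fun_prop

/-- For an irreducible aperiodic chain, the square of the `L²` operator has no fixed vector of
mean zero. -/
theorem eq_zero_of_l2Op_l2Op_eq (hinv : P.Invariant π) (hirr : IsPhiIrreducible P)
    (haper : IsAperiodic P π) {G : Lp ℝ 2 π} (hG0 : ∫ x, G x ∂π = 0)
    (hG : l2Op hinv (l2Op hinv G) = G) : G = 0 := by
  -- The factorisation T² - 1 = (T - 1)(T + 1): T G + G is harmonic of mean zero, hence zero.
  have hsum : l2Op hinv G = -G := by
    rw [← add_eq_zero_iff_eq_neg]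
    have hfix : l2Op hinv (l2Op hinv G + G) = l2Op hinv G + G := by
      rw [map_add, hG, add_comm]
    refine Lp.eq_zero_iff_ae_eq_zero.2 (ae_eq_zero_of_harmonic hinv hirr
      (Lp.stronglyMeasurable _).measurable (Lp.memLp _) ?_ ?_)
    · rw [integral_congr_ae (Lp.coeFn_add _ _)]
      simp only [Pi.add_apply]
      rw [integral_add ((Lp.memLp _).integrable (by norm_num))
        ((Lp.memLp _).integrable (by norm_num)), integral_l2Op, hG0, add_zero]
    · exact (coeFn_l2Op hinv _).symm.trans (by rw [hfix])
  refine Lp.eq_zero_iff_ae_eq_zero.2 (ae_eq_zero_of_kernelOp_eq_neg hinv haper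
    (Lp.stronglyMeasurable _).measurable (Lp.memLp _) hG0 ?_)
  refine (coeFn_l2Op hinv _).symm.trans ?_
  rw [hsum]
  exact Lp.coeFn_neg _

theorem tendsto_l2Inner_iterate_even (hrev : P.IsReversible π) (hirr : IsPhiIrreducible P)
    (haper : IsAperiodic P π) {f : 𝒳 → ℝ} (hf : MemLp f 2 π) (hf0 : ∫ x, f x ∂π = 0) :
    Tendsto (fun k => l2Inner π f ((kernelOp P)^[2 * k] f)) atTop (𝓝 0) := by
  obtain ⟨G, hG, hlim⟩ := exists_tendsto_iterate_even (l2Op_symm hrev)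
    (norm_l2Op_le hrev.invariant) hf.toLp
  -- The iterates keep mean zero, and the mean is continuous.
  have hG0 : ∫ x, G x ∂π = 0 := by
    refine tendsto_nhds_unique ((continuous_integral_l2.tendsto G).comp hlim) ?_
    refine tendsto_const_nhds.congr fun k => ?_
    rw [Function.comp_apply, integral_iterate_l2Op, integral_congr_ae hf.coeFn_toLp, hf0]
  rw [eq_zero_of_l2Op_l2Op_eq hrev.invariant hirr haper hG0 hG] at hlim
  simp only [l2Inner_iterate_eq_inner hrev.invariant hf]
  simpa using (tendsto_const_nhds (x := hf.toLp)).inner (𝕜 := ℝ) hlim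

end L2

/-! ### The stationary chain and its covariances. -/

section Chain

variable [IsMarkovKernel P]

theorem map_eval_zero_chainLaw : (chainLaw P π).map (fun ω => ω 0) = π := by
  have h0 : (fun ω : ℕ → 𝒳 => ω 0) =
      (fun h : (i : Finset.Iic 0) → 𝒳 => h ⟨0, Finset.mem_Iic.2 le_rfl⟩) ∘
        Preorder.frestrictLe (π := fun _ => 𝒳) 0 := rfl
  rw [h0, ← Measure.map_map (by fun_prop) (Preorder.measurable_frestrictLe (X := fun _ => 𝒳) 0), chainLaw,
    Kernel.trajMeasure, Measure.map_comp _ _ (Preorder.measurable_frestrictLe 0),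
    Kernel.traj_map_frestrictLe, Kernel.partialTraj_self, Measure.id_comp,
    Measure.map_map (measurable_pi_apply _) (MeasurableEquiv.measurable _)]
  exact Measure.map_id

variable [IsProbabilityMeasure π]

instance : IsProbabilityMeasure (chainLaw P π) := by
  unfold chainLaw
  infer_instance

theorem map_frestrictLe_compProd (n : ℕ) :
    ((chainLaw P π).map (Preorder.frestrictLe n)) ⊗ₘ
      P.comap (fun h : (i : Finset.Iic n) → 𝒳 => h ⟨n, Finset.mem_Iic.2 le_rfl⟩)
        (measurable_pi_apply _) =
    (chainLaw P π).map (fun ω => (Preorder.frestrictLe n ω, ω (n + 1))) :=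
  Kernel.map_frestrictLe_trajMeasure_compProd_eq_map_trajMeasure

/-- Second marginal of the joint law of history and next state, as the transition depends on the
history only through its last state. -/
theorem map_eval_succ_chainLaw (n : ℕ) :
    (chainLaw P π).map (fun ω => ω (n + 1)) = P ∘ₘ ((chainLaw P π).map fun ω => ω n) := by
  have hm : Measurable fun ω : ℕ → 𝒳 => (Preorder.frestrictLe (π := fun _ => 𝒳) n ω, ω (n + 1)) :=
    (Preorder.measurable_frestrictLe n).prodMk (measurable_pi_apply _)
  have h := congrArg Measure.snd (map_frestrictLe_compProd (π := π) (P := P) n)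
  rw [Measure.snd_compProd, Measure.snd, Measure.map_map measurable_snd hm] at h
  refine Eq.trans h.symm ?_
  ext s hs
  rw [Measure.bind_apply hs (Kernel.aemeasurable _), Measure.bind_apply hs (Kernel.aemeasurable _),
    lintegral_map (Kernel.measurable_coe _ hs) (Preorder.measurable_frestrictLe n),
    lintegral_map (Kernel.measurable_coe _ hs) (measurable_pi_apply _)]
  rfl

/-- Started from an invariant law, the chain is distributed according to this law at all times. -/
theorem measurePreserving_eval_chainLaw (hinv : P.Invariant π) (n : ℕ) :
    MeasurePreserving (fun ω : ℕ → 𝒳 => ω n) (chainLaw P π) π := by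
  refine ⟨measurable_pi_apply _, ?_⟩
  induction n with
  | zero => exact map_eval_zero_chainLaw
  | succ n ih => rw [map_eval_succ_chainLaw, ih, hinv.def]

theorem memLp_eval_chainLaw (hinv : P.Invariant π) {f : 𝒳 → ℝ} (hf : MemLp f 2 π) (n : ℕ) :
    MemLp (fun ω : ℕ → 𝒳 => f (ω n)) 2 (chainLaw P π) :=
  hf.comp_measurePreserving (measurePreserving_eval_chainLaw hinv n)

theorem integral_eval_chainLaw (hinv : P.Invariant π) {f : 𝒳 → ℝ}
    (hf : AEStronglyMeasurable f π) (n : ℕ) :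
    ∫ ω, f (ω n) ∂(chainLaw P π) = ∫ x, f x ∂π := by
  have hm := measurePreserving_eval_chainLaw (P := P) hinv n
  conv_rhs => rw [← hm.map_eq]
  rw [integral_map hm.measurable.aemeasurable (by rwa [hm.map_eq])]

/-- The Markov property, integrated against a function of an earlier state. -/
theorem integral_mul_eval_succ (hinv : P.Invariant π) {f g : 𝒳 → ℝ} (hf : MemLp f 2 π)
    (hg : MemLp g 2 π) {i n : ℕ} (hin : i ≤ n) :
    ∫ ω, f (ω i) * g (ω (n + 1)) ∂(chainLaw P π) =
      ∫ ω, f (ω i) * kernelOp P g (ω n) ∂(chainLaw P π) := by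
  have hr : Measurable (Preorder.frestrictLe (π := fun _ : ℕ => 𝒳) n) :=
    Preorder.measurable_frestrictLe n
  have hm : Measurable fun ω : ℕ → 𝒳 => (Preorder.frestrictLe (π := fun _ => 𝒳) n ω, ω (n + 1)) :=
    hr.prodMk (measurable_pi_apply _)
  let κ := P.comap (fun h : (i : Finset.Iic n) → 𝒳 => h ⟨n, Finset.mem_Iic.2 le_rfl⟩)
        (measurable_pi_apply _)
  let F : ((j : Finset.Iic n) → 𝒳) × 𝒳 → ℝ := fun p => f (p.1 ⟨i, Finset.mem_Iic.2 hin⟩) * g p.2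
  have hlaw (j : ℕ) (hj : j ≤ n) : MeasurePreserving
      (fun h : (i : Finset.Iic n) → 𝒳 => h ⟨j, Finset.mem_Iic.2 hj⟩)
      ((chainLaw P π).map (Preorder.frestrictLe n)) π := by
    refine ⟨measurable_pi_apply _, ?_⟩
    rw [Measure.map_map (measurable_pi_apply _) hr]
    exact (measurePreserving_eval_chainLaw hinv j).map_eq
  have hprod : MeasurePreserving
      (fun ω : ℕ → 𝒳 => (Preorder.frestrictLe (π := fun _ => 𝒳) n ω, ω (n + 1))) (chainLaw P π)
      (((chainLaw P π).map (Preorder.frestrictLe n)) ⊗ₘ κ) :=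
    ⟨hm, (map_frestrictLe_compProd n).symm⟩
  have hsnd : MeasurePreserving Prod.snd
      (((chainLaw P π).map (Preorder.frestrictLe n)) ⊗ₘ κ) π := by
    refine ⟨measurable_snd, ?_⟩
    rw [← hprod.map_eq, Measure.map_map measurable_snd hm]
    exact (measurePreserving_eval_chainLaw hinv (n + 1)).map_eq
  have : IsProbabilityMeasure ((chainLaw P π).map (Preorder.frestrictLe n)) :=
    Measure.isProbabilityMeasure_map hr.aemeasurable
  have hfst : MeasurePreserving (fun p : ((j : Finset.Iic n) → 𝒳) × 𝒳 => p.1)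
      (((chainLaw P π).map (Preorder.frestrictLe n)) ⊗ₘ κ)
      ((chainLaw P π).map (Preorder.frestrictLe n)) := ⟨measurable_fst, Measure.fst_compProd _ _⟩
  have hF : Integrable F (((chainLaw P π).map (Preorder.frestrictLe n)) ⊗ₘ κ) :=
    (hf.comp_measurePreserving ((hlaw i hin).comp hfst)).integrable_mul
      (hg.comp_measurePreserving hsnd)
  calc ∫ ω, f (ω i) * g (ω (n + 1)) ∂(chainLaw P π)
      = ∫ p, F p ∂(((chainLaw P π).map (Preorder.frestrictLe n)) ⊗ₘ κ) := by
        rw [← hprod.map_eq, integral_map hm.aemeasurable (by rw [hprod.map_eq]; exact hF.1)]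
        rfl
    _ = ∫ h, f (h ⟨i, Finset.mem_Iic.2 hin⟩) * kernelOp P g (h ⟨n, Finset.mem_Iic.2 le_rfl⟩)
          ∂((chainLaw P π).map (Preorder.frestrictLe n)) := by
        rw [Measure.integral_compProd hF]
        exact integral_congr_ae (ae_of_all _ fun h => integral_const_mul (f (h _)) g)
    _ = ∫ ω, f (ω i) * kernelOp P g (ω n) ∂(chainLaw P π) := by
        rw [integral_map hr.aemeasurable]
        · rfl
        · exact (hf.1.comp_measurePreserving (hlaw i hin)).mul
            ((aestronglyMeasurable_kernelOp hinv hg.1).comp_measurePreserving (hlaw n le_rfl))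

theorem integral_mul_eval_add (hinv : P.Invariant π) {f g : 𝒳 → ℝ} (hf : MemLp f 2 π)
    (hg : MemLp g 2 π) (i k : ℕ) :
    ∫ ω, f (ω i) * g (ω (i + k)) ∂(chainLaw P π) = l2Inner π f ((kernelOp P)^[k] g) := by
  -- Each application of the Markov property replaces g by `kernelOp P g`, hence the general g.
  induction k generalizing g with
  | zero => exact integral_eval_chainLaw hinv (hf.1.mul hg.1) i
  | succ k ih =>
    rw [← add_assoc, integral_mul_eval_succ hinv hf hg (Nat.le_add_right i k),
      ih (memLp_kernelOp hinv hg), Function.iterate_succ_apply]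

theorem covariance_eval_add (hinv : P.Invariant π) {f : 𝒳 → ℝ} (hf : MemLp f 2 π)
    (hf0 : ∫ x, f x ∂π = 0) (i k : ℕ) :
    cov[fun ω : ℕ → 𝒳 => f (ω i), fun ω : ℕ → 𝒳 => f (ω (i + k)); chainLaw P π] =
      l2Inner π f ((kernelOp P)^[k] f) := by
  rw [covariance_eq_sub (memLp_eval_chainLaw hinv hf i) (memLp_eval_chainLaw hinv hf (i + k)),
    integral_eval_chainLaw hinv hf.1, hf0, zero_mul, sub_zero]
  exact integral_mul_eval_add hinv hf hf i k

theorem autocov_eq_l2Inner (hinv : P.Invariant π) {f : 𝒳 → ℝ} (hf : MemLp f 2 π)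
    (hf0 : ∫ x, f x ∂π = 0) (k : ℕ) :
    autocov P π f k = l2Inner π f ((kernelOp P)^[k] f) := by
  have h := covariance_eval_add hinv hf hf0 0 k
  rwa [zero_add] at h

theorem variance_sum_eval (hinv : P.Invariant π) {f : 𝒳 → ℝ} (hf : MemLp f 2 π)
    (hf0 : ∫ x, f x ∂π = 0) (N : ℕ) :
    Var[fun ω : ℕ → 𝒳 => ∑ k ∈ Finset.range N, f (ω k); chainLaw P π] =
      ∑ n ∈ Finset.range N, (l2Inner π f ((kernelOp P)^[0] f) +
        2 * ∑ k ∈ Finset.Icc 1 n, l2Inner π f ((kernelOp P)^[k] f)) := by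
  have hL (n : ℕ) := memLp_eval_chainLaw hinv hf n
  induction N with
  | zero => simp [variance, evariance]
  | succ N ih =>
    have hvar : Var[fun ω : ℕ → 𝒳 => f (ω N); chainLaw P π] =
        l2Inner π f ((kernelOp P)^[0] f) := by
      rw [← covariance_self (hL N).1.aemeasurable]
      exact covariance_eval_add hinv hf hf0 N 0
    have hcov : cov[fun ω : ℕ → 𝒳 => ∑ k ∈ Finset.range N, f (ω k),
        fun ω : ℕ → 𝒳 => f (ω N); chainLaw P π] =
        ∑ k ∈ Finset.Icc 1 N, l2Inner π f ((kernelOp P)^[k] f) := by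
      rw [covariance_fun_sum_left' (fun i _ => hL i) (hL N)]
      -- States i < N and N are at lag N - i, which runs over 1, …, N.
      refine Finset.sum_bij' (fun i _ => N - i) (fun k _ => N - k) ?_ ?_ ?_ ?_ ?_
      · intro i hi; rw [Finset.mem_range] at hi; rw [Finset.mem_Icc]; omega
      · intro k hk; rw [Finset.mem_Icc] at hk; rw [Finset.mem_range]; omega
      · intro i hi; rw [Finset.mem_range] at hi; omega
      · intro k hk; rw [Finset.mem_Icc] at hk; omega
      · intro i hi
        rw [Finset.mem_range] at hi
        rw [← covariance_eval_add hinv hf hf0 i (N - i), Nat.add_sub_cancel' hi.le]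
    simp only [Finset.sum_range_succ _ N]
    rw [variance_fun_add (memLp_finsetSum _ fun i _ => hL i) (hL N), ih, hvar, hcov]
    ring

end Chain

/-! ### Assembly. -/

theorem exists_hasAsymptoticVariance [IsMarkovKernel P] [IsProbabilityMeasure π]
    (hrev : Kernel.IsReversible P π)
    (hirr : IsPhiIrreducible P)
    (haper : IsAperiodic P π)
    {f : 𝒳 → ℝ} (hf : MemLp f 2 π) (hf0 : ∫ x, f x ∂π = 0) :
    ∃ v s t : EReal,
      HasAsymptoticVariance P π f v ∧
      HasSeriesSum
        (fun k => l2Inner π f ((kernelOp P)^[k] f)) s ∧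
      HasSeriesSum (fun k => autocov P π f k) t ∧
      v = ((l2Norm π f ^ 2 : ℝ) : EReal) + 2 * s ∧
      v = (autocov P π f 0 : EReal) + 2 * t := by
  have hinv := hrev.invariant
  obtain ⟨s, hs, hv⟩ := exists_hasSeriesSum_and_tendsto_cesaro
    (a := fun k => l2Inner π f ((kernelOp P)^[k] f))
    (fun k => by
      simp only [l2Inner_iterate_eq_inner hinv hf]
      exact inner_iterate_pair_nonneg (l2Op_symm hrev) (norm_l2Op_le hinv) _ k)
    (fun k => by
      simp only [l2Inner_iterate_eq_inner hinv hf]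
      exact inner_iterate_even_nonneg (l2Op_symm hrev) _ k)
    (tendsto_l2Inner_iterate_even hrev hirr haper hf hf0)
  -- The two series agree term by term, so one value s serves for both.
  refine ⟨(autocov P π f 0 : EReal) + 2 * s, s, s, ?_, hs, ?_, ?_, rfl⟩
  · unfold HasAsymptoticVariance
    simp only [variance_sum_eval hinv hf hf0, one_div, autocov_eq_l2Inner hinv hf hf0]
    exact hv
  · simpa only [autocov_eq_l2Inner hinv hf hf0] using hs
  · have h0 : 0 ≤ l2Inner π f f := integral_nonneg fun x => mul_self_nonneg (f x)
    rw [autocov_eq_l2Inner hinv hf hf0, l2Norm, Real.sq_sqrt h0]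
    rfl

end ReversibleChain

theorem proposition3p4 {𝒳 : Type*} [MeasurableSpace 𝒳] (π : Measure 𝒳) [IsProbabilityMeasure π]
    (P : Kernel 𝒳 𝒳) [IsMarkovKernel P]
    (hrev : Kernel.IsReversible P π)
    (hirr : ReversibleChain.IsPhiIrreducible P)
    (haper : ReversibleChain.IsAperiodic P π)
    (f : 𝒳 → ℝ) (hf : MemLp f 2 π) (hf0 : ∫ x, f x ∂π = 0) :
    ∃ v s t : EReal,
      ReversibleChain.HasAsymptoticVariance P π f v ∧
      ReversibleChain.HasSeriesSum
        (fun k => ReversibleChain.l2Inner π f ((ReversibleChain.kernelOp P)^[k] f)) s ∧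
      ReversibleChain.HasSeriesSum (fun k => ReversibleChain.autocov P π f k) t ∧
      v = ((ReversibleChain.l2Norm π f ^ 2 : ℝ) : EReal) + 2 * s ∧
      v = (ReversibleChain.autocov P π f 0 : EReal) + 2 * t := by
  exact ReversibleChain.exists_hasAsymptoticVariance hrev hirr haper hf hf0
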